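/- **Proposition 14.** Let $\mathcal A$ be a finite alphabet and let $\Sigma\subset\mathcal A^{\mathbb N}$ be a one-sided subshift of finite type (the set of sequences in which no word of some fixed finite set of forbidden words occurs), with shift map $\sigma(x_0,x_1,\dots)=(x_1,x_2,\dots)$. Assume $\sigma:\Sigma\to\Sigma$ is topologically transitive: for all nonempty open $U,V\subset\Sigma$ there is $n\ge 0$ with $\sigma^n(U)\cap V\ne\emptyset$. Fix $\lambda\in(0,1)$ and equip $\Sigma$ with the metric $d(\mathbf x,\mathbf y)=\lambda^{\min\{j:\,x_j\neq y_j\}}$ for $\mathbf x\ne\mathbf y$, $d(\mathbf x,\mathbf x)=0$. Let $\mathcal M_\sigma$ be the set of $\sigma$-invariant Borel probability measures on $\Sigma$. Let $\varphi:\Sigma\to\mathbb Q$ be locally constant, i.e. there is $j\ge 0$ such that $\varphi(\mathbf x)=\varphi(\mathbf y)$ whenever $x_0=y_0,\dots,x_j=y_j$. For $\mu\in\mathcal M_\sigma$ write $\varphi_*(\mu)=\int\varphi\,d\mu$ (the rotation number of $\mu$); the set $\varphi_*(\mathcal M_\sigma)\subset\mathbb R$ is the rotation set. Let $A:\Sigma\to\mathbb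 R$ be a Walters potential, i.e. a continuous function for which there is a nondecreasing $H:[0,\infty)\to[0,\infty]$ with $H(0)=0$, continuous at $0$, such that for all $s\ge 0$, all integers $k>0$ and all $\mathbf x,\mathbf y\in\Sigma$, $$\max_{0\le j<k}d(\sigma^j\mathbf x,\sigma^j\mathbf y)\le s\ \Longrightarrow\ \Bigl|\sum_{j=0}^{k-1}A(\sigma^j\mathbf x)-\sum_{j=0}^{k-1}A(\sigma^j\mathbf y)\Bigr|\le H(s).$$ For $h\in\varphi_*(\mathcal M_\sigma)$ let $\beta_{A,\varphi}(h)=\sup\{\int A\,d\mu:\ \mu\in\mathcal M_\sigma,\ \varphi_*(\mu)=h\}$. A periodic probability measure is a measure $\frac1M\sum_{j=0}^{M-1}\delta_{\sigma^j(\mathbf x)}$ with $\mathbf x\in\Sigma$, $M\ge 1$ and $\sigma^M(\mathbf x)=\mathbf x$. If $r$ is a rational number in the interior (in $\mathbb R$) of $\varphi_*(\mathcal M_\sigma)$, then $$\beta_{A,\varphi}(r)=\sup\Bigl\{\int A\,d\mu:\ \mu\in\mathcal M_\sigma,\ \varphi_*(\mu)=r,\ \mu\text{ a periodic probability measure}\Bigr\},$$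 where the set on the right is nonempty. -/

import Mathlib

open MeasureTheory SymbolicDynamics.FullShift
open scoped NNReal ENNReal

noncomputable section

namespace ErgOpt

section General

variable {X : Type*}

/-- Topological transitivity of `T`: every nonempty open set meets some forward image of every
nonempty open set. -/
def IsTransitive [TopologicalSpace X] (T : X → X) : Prop :=
  ∀ U V : Set X, IsOpen U → IsOpen V → U.Nonempty → V.Nonempty →
    ∃ n : ℕ, (T^[n] '' U ∩ V).Nonempty

/-- The `T`-invariant probability measures. -/
def invariantMeasures [MeasurableSpace X] (T : X → X) : Set (Measure X) :=
  {μ | IsProbabilityMeasure μ ∧ MeasurePreserving T μ μ}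

/-- The rotation number of `μ` for the constraint `φ`. -/
def rotationNumber [MeasurableSpace X] (φ : X → ℝ) (μ : Measure X) : ℝ :=
  ∫ x, φ x ∂μ

/-- The rotation set: all rotation numbers of invariant probability measures. -/
def rotationSet [MeasurableSpace X] (T : X → X) (φ : X → ℝ) : Set ℝ :=
  rotationNumber φ '' invariantMeasures T

/-- The rotation class of `h`: the invariant probability measures with rotation number `h`. -/
def rotationClass [MeasurableSpace X] (T : X → X) (φ : X → ℝ) (h : ℝ) : Set (Measure X) :=
  {μ | μ ∈ invariantMeasures T ∧ rotationNumber φ μ = h}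

/-- The beta function, at points `h` of the rotation set. -/
def beta [MeasurableSpace X] (T : X → X) (A φ : X → ℝ) (h : ℝ) : ℝ :=
  sSup ((fun μ : Measure X => ∫ x, A x ∂μ) '' rotationClass T φ h)

/-- `μ` is equidistributed on a periodic orbit. Every positive period `M` of the point `x`, minimal
or not, gives the same measure. -/
def IsPeriodicMeasure [MeasurableSpace X] (T : X → X) (μ : Measure X) : Prop :=
  ∃ (x : X) (M : ℕ), 0 < M ∧ Function.IsPeriodicPt T M x ∧
    μ = (M : ℝ≥0∞)⁻¹ • ∑ j ∈ Finset.range M, Measure.dirac (T^[j] x)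

/-- The dynamical distance `max_{0 ≤ j < k} d (T^j x) (T^j y)`. -/
def dynDist (T : X → X) (d : X → X → ℝ≥0) (k : ℕ) (x y : X) : ℝ≥0 :=
  (Finset.range k).sup fun j => d (T^[j] x) (T^[j] y)

/-- Walters functions, for a distance `d` inducing the topology of `X`: continuous functions
with a Walters module `H`. -/
def IsWalters [TopologicalSpace X] (T : X → X) (d : X → X → ℝ≥0) (A : X → ℝ) : Prop :=
  Continuous A ∧ ∃ H : ℝ≥0 → ℝ≥0∞, Monotone H ∧ H 0 = 0 ∧ ContinuousAt H 0 ∧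
    ∀ (s : ℝ≥0) (k : ℕ), 0 < k → ∀ x y : X, dynDist T d k x y ≤ s →
      ENNReal.ofReal |birkhoffSum T A k x - birkhoffSum T A k y| ≤ H s

end General

section Symbolic

variable {α : Type*} [TopologicalSpace α]

/-- A one-sided subshift is of finite type if it consists of the sequences in which no word of
some finite set `F` of forbidden words occurs. -/
def IsFiniteType (S : Subshift α ℕ) : Prop :=
  ∃ F : Set (List α), F.Finite ∧
    S.carrier = {x | ∀ w ∈ F, ∀ i : ℕ, List.ofFn (fun k : Fin w.length => x (i + k)) ≠ w}

/-- The left shift `(x₀, x₁, …) ↦ (x₁, x₂, …)` on a one-sided subshift. -/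
def shiftMap (S : Subshift α ℕ) : S.carrier → S.carrier :=
  (S.mapsTo 1).restrict

/-- The distance `lam ^ min {j | x j ≠ y j}` (and `0` if `x = y`). For `0 < lam < 1` and a discrete
alphabet it induces the product topology. -/
def shiftDist (S : Subshift α ℕ) (lam : ℝ≥0) (x y : S.carrier) : ℝ≥0 :=
  open Classical in
  if x = y then 0 else lam ^ PiNat.firstDiff (E := fun _ => α) x.1 y.1

/-- `g` depends only on the coordinates `0, …, j`, for some `j`. -/
def IsLocConst {β : Type*} (S : Subshift α ℕ) (g : S.carrier → β) : Prop :=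
  ∃ j : ℕ, ∀ x y : S.carrier, (∀ i ≤ j, x.1 i = y.1 i) → g x = g y

end Symbolic

end ErgOpt

end

open Filter Topology

/-! Finite type and transitivity turn the shift into a finite graph: orbit segments concatenate,
connect any two cylinders and close up to periodic orbits. Closing up costs a bounded amount, so a
function of finitely many coordinates with nonpositive sums over periodic orbits has nonpositive
integrals (`integral_nonpos_of_isPeriodicPt`). Approximate `A` uniformly by such a `g`, and put `ψ =
g - c` with `c` just below `∫ g dμ`. Suppose no periodic orbit has zero drift (sum of `φ - r`) and
positive `ψ`-sum. Since drifts are rational, loops of opposite drift balance exactly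
(`exists_isPeriodicPt_balanced`), so some multiplier `a` separates the ratios `ψ`/drift of positive
and negative orbits. Then `ψ - a (φ - r)` has nonpositive periodic sums, contradicting `∫ ψ dμ > 0`.
Interiority of `r` supplies orbits of both signs. -/

namespace ErgOpt

/-! ### Orbit segments between cylinders -/

section Paths

variable {α : Type*} [TopologicalSpace α] {S : Subshift α ℕ} {N : ℕ}

/-- Agreement of two points of a subshift on the coordinates `0, …, N - 1`. -/
def Agree (N : ℕ) (x y : S.carrier) : Prop :=
  ∀ i < N, x.1 i = y.1 i

/-- Membership in `S` is decided by the windows of length `N + 1`. -/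
def HasMemory (S : Subshift α ℕ) (N : ℕ) : Prop :=
  ∀ x : ℕ → α, (∀ i, ∃ y ∈ S.carrier, ∀ k ≤ N, x (i + k) = y k) → x ∈ S.carrier

/-- `g` depends only on the coordinates `0, …, N - 1`. -/
def DependsOnPrefix {β : Type*} (N : ℕ) (g : S.carrier → β) : Prop :=
  ∀ x y : S.carrier, Agree N x y → g x = g y

/-- There is an orbit segment of length `n` from the `N`-cylinder of `x` to that of `y` with
Birkhoff sum `w`. -/
def HasPath {G : Type*} [AddCommMonoid G] (N : ℕ) (f : S.carrier → G) (x y : S.carrier) (n : ℕ)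
    (w : G) : Prop :=
  ∃ z : S.carrier, Agree N z x ∧ Agree N ((shiftMap S)^[n] z) y ∧
    birkhoffSum (shiftMap S) f n z = w

theorem Agree.symm {x y : S.carrier} (h : Agree N x y) : Agree N y x :=
  fun i hi => (h i hi).symm

theorem Agree.trans {x y z : S.carrier} (h : Agree N x y) (h' : Agree N y z) : Agree N x z :=
  fun i hi => (h i hi).trans (h' i hi)

theorem HasMemory.mono {N' : ℕ} (h : HasMemory S N) (hN : N ≤ N') : HasMemory S N' :=
  fun x hx => h x fun i => (hx i).imp fun _ hy => ⟨hy.1, fun k hk => hy.2 k (hk.trans hN)⟩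

theorem DependsOnPrefix.mono {β : Type*} {N' : ℕ} {g : S.carrier → β} (h : DependsOnPrefix N g)
    (hN : N ≤ N') : DependsOnPrefix N' g :=
  fun x y hxy => h x y fun i hi => hxy i (hi.trans_le hN)

theorem IsLocConst.exists_dependsOnPrefix {β : Type*} {g : S.carrier → β} (h : IsLocConst S g) :
    ∃ N, DependsOnPrefix N g := by
  obtain ⟨j, hj⟩ := h
  exact ⟨j + 1, fun x y hxy => hj x y fun i hi => hxy i (by omega)⟩

theorem IsFiniteType.exists_hasMemory (hS : IsFiniteType S) : ∃ N, HasMemory S N := by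
  obtain ⟨F, hF, hSF⟩ := hS
  obtain ⟨N, hN⟩ := (hF.image List.length).bddAbove
  refine ⟨N, fun x hx => ?_⟩
  rw [hSF]
  intro w hw i hi
  obtain ⟨y, hy, hxy⟩ := hx i
  rw [hSF] at hy
  refine hy w hw 0 ?_
  have hlen : w.length ≤ N := hN ⟨w, hw, rfl⟩
  refine (congrArg List.ofFn (funext fun k => ?_)).trans hi
  rw [zero_add, hxy k (k.2.le.trans hlen)]

theorem coe_iterate_shiftMap (x : S.carrier) (n i : ℕ) :
    ((shiftMap S)^[n] x).1 i = x.1 (n + i) := by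
  induction n generalizing x with
  | zero => simp
  | succ n ih =>
    rw [Function.iterate_succ_apply, ih]
    exact congrArg x.1 (by omega : 1 + (n + i) = n + 1 + i)

/-- The overlap of `N` symbols puts every window of length `N + 1` of the glued sequence inside `x`
or inside `y`. -/
theorem exists_concat (hS : HasMemory S N) {x y : S.carrier} {n : ℕ}
    (h : Agree N ((shiftMap S)^[n] x) y) :
    ∃ z : S.carrier, (∀ i < n + N, z.1 i = x.1 i) ∧ (shiftMap S)^[n] z = y := by
  have hxy : ∀ i < N, x.1 (n + i) = y.1 i := fun i hi => by
    rw [← coe_iterate_shiftMap, h i hi]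
  let z : ℕ → α := fun i => if i < n then x.1 i else y.1 (i - n)
  have hzx : ∀ i < n + N, z i = x.1 i := by
    intro i hi
    by_cases h' : i < n
    · simp [z, h']
    · simp only [z, h', if_false]
      rw [← hxy _ (by omega)]
      exact congrArg x.1 (by omega)
  have hzy : ∀ i, z (n + i) = y.1 i := by
    intro i
    simp [z]
  refine ⟨⟨z, hS z fun i => ?_⟩, hzx, Subtype.ext (funext fun i => ?_)⟩
  · rcases lt_or_ge i n with hi | hi
    · refine ⟨_, ((shiftMap S)^[i] x).2, fun k hk => ?_⟩
      rw [coe_iterate_shiftMap, hzx _ (by omega)]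
    · refine ⟨_, ((shiftMap S)^[i - n] y).2, fun k hk => ?_⟩
      rw [coe_iterate_shiftMap, ← hzy]
      congr 1
      omega
  · rw [coe_iterate_shiftMap]
    exact hzy i

variable {G : Type*} [AddCommMonoid G] {f : S.carrier → G}

theorem birkhoffSum_eq_of_eq_prefix (hf : DependsOnPrefix N f) {x y : S.carrier} {n : ℕ}
    (h : ∀ i < n + N, x.1 i = y.1 i) :
    birkhoffSum (shiftMap S) f n x = birkhoffSum (shiftMap S) f n y := by
  refine Finset.sum_congr rfl fun k hk => hf _ _ fun i hi => ?_
  rw [Finset.mem_range] at hk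
  rw [coe_iterate_shiftMap, coe_iterate_shiftMap, h _ (by omega)]

theorem HasPath.trans (hS : HasMemory S N) (hf : DependsOnPrefix N f) {x y t : S.carrier}
    {n m : ℕ} {v w : G} (h : HasPath N f x y n v) (h' : HasPath N f y t m w) :
    HasPath N f x t (n + m) (v + w) := by
  obtain ⟨p, hpx, hpy, rfl⟩ := h
  obtain ⟨q, hqy, hqt, rfl⟩ := h'
  obtain ⟨z, hzp, rfl⟩ := exists_concat hS (hpy.trans hqy.symm)
  refine ⟨z, fun i hi => (hzp i (by omega)).trans (hpx i hi), ?_, ?_⟩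
  · rwa [add_comm, Function.iterate_add_apply]
  · rw [birkhoffSum_add, birkhoffSum_eq_of_eq_prefix hf hzp]

theorem HasPath.refl (x : S.carrier) : HasPath N f x x 0 0 :=
  ⟨x, fun _ _ => rfl, fun _ _ => rfl, rfl⟩

theorem HasPath.nsmul (hS : HasMemory S N) (hf : DependsOnPrefix N f) {x : S.carrier}
    {n : ℕ} {v : G} (h : HasPath N f x x n v) (k : ℕ) : HasPath N f x x (k * n) (k • v) := by
  induction k with
  | zero => simpa using HasPath.refl x
  | succ k ih =>
    rw [add_mul, one_mul, succ_nsmul]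
    exact ih.trans hS hf h

theorem hasPath_iterate (x : S.carrier) (n : ℕ) :
    HasPath N f x ((shiftMap S)^[n] x) n (birkhoffSum (shiftMap S) f n x) :=
  ⟨x, fun _ _ => rfl, fun _ _ => rfl, rfl⟩

theorem hasPath_of_isPeriodicPt {x : S.carrier} {n : ℕ}
    (hx : Function.IsPeriodicPt (shiftMap S) n x) :
    HasPath N f x x n (birkhoffSum (shiftMap S) f n x) := by
  simpa [hx.eq] using hasPath_iterate (N := N) (f := f) x n

/-- A nontrivial loop is shadowed by a periodic point with the same Birkhoff sum. -/
theorem HasPath.exists_isPeriodicPt (hS : HasMemory S N) (hf : DependsOnPrefix N f)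
    {x : S.carrier} {n : ℕ} {v : G} (hn : 0 < n) (h : HasPath N f x x n v) :
    ∃ z : S.carrier, Function.IsPeriodicPt (shiftMap S) n z ∧
      birkhoffSum (shiftMap S) f n z = v := by
  obtain ⟨p, hpx, hpy, rfl⟩ := h
  have hp : ∀ i < N, p.1 (n + i) = p.1 i := fun i hi => by
    rw [← coe_iterate_shiftMap, (hpy.trans hpx.symm) i hi]
  -- `N` may exceed `n`, so the index may have to be reduced by `n` several times.
  have hmod : ∀ i < n + N, p.1 (i % n) = p.1 i := by
    intro i
    induction i using Nat.strong_induction_on with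
    | _ i ih =>
      intro hi
      rcases lt_or_ge i n with h' | h'
      · rw [Nat.mod_eq_of_lt h']
      · rw [Nat.mod_eq_sub_mod h', ih (i - n) (by omega) (by omega), ← hp _ (by omega)]
        exact congrArg p.1 (by omega)
  have hz : (fun i => p.1 (i % n)) ∈ S.carrier := hS _ fun i => by
    refine ⟨_, ((shiftMap S)^[i % n] p).2, fun k hk => ?_⟩
    have := Nat.mod_lt i hn
    rw [coe_iterate_shiftMap, ← hmod (i % n + k) (by omega), Nat.mod_add_mod]
  refine ⟨⟨_, hz⟩, Subtype.ext (funext fun i => ?_), birkhoffSum_eq_of_eq_prefix hf hmod⟩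
  rw [coe_iterate_shiftMap]
  simp

theorem isOpen_setOf_agree [DiscreteTopology α] (x : S.carrier) :
    IsOpen {y : S.carrier | Agree N y x} := by
  have : {y : S.carrier | Agree N y x} =
      ⋂ i ∈ Finset.range N, (fun y : S.carrier => y.1 i) ⁻¹' {x.1 i} := by
    ext y
    simp [Agree]
  rw [this]
  exact isOpen_biInter_finset fun i _ =>
    (isOpen_discrete _).preimage ((continuous_apply i).comp continuous_subtype_val)

theorem IsTransitive.exists_hasPath [DiscreteTopology α] (hT : IsTransitive (shiftMap S))
    (N : ℕ) (f : S.carrier → G) (x y : S.carrier) : ∃ n w, HasPath N f x y n w := by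
  obtain ⟨n, -, ⟨z, hz, rfl⟩, hzy⟩ := hT {z | Agree N z x} {z | Agree N z y}
    (isOpen_setOf_agree x) (isOpen_setOf_agree y) ⟨x, fun _ _ => rfl⟩ ⟨y, fun _ _ => rfl⟩
  exact ⟨n, _, z, hz, hzy, rfl⟩

theorem exists_finite_agree [Finite α] (S : Subshift α ℕ) (N : ℕ) :
    ∃ ρ : S.carrier → S.carrier, (Set.range ρ).Finite ∧ DependsOnPrefix N ρ ∧
      ∀ x, Agree N (ρ x) x := by
  let π : S.carrier → (Fin N → α) := fun x i => x.1 i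
  let ρ : Set.range π → S.carrier := fun v => v.2.choose
  have hρ : ∀ v, π (ρ v) = v.1 := fun v => v.2.choose_spec
  refine ⟨fun x => ρ ⟨π x, x, rfl⟩, ?_, fun x y h => ?_, fun x i hi => ?_⟩
  · exact (Set.toFinite (Set.range ρ)).subset (Set.range_subset_iff.2 fun x => ⟨_, rfl⟩)
  · have : π x = π y := funext fun i => h i i.2
    simp only [this]
  · exact congrFun (hρ ⟨π x, x, rfl⟩) ⟨i, hi⟩

theorem DependsOnPrefix.finite_range {β : Type*} [Finite α] {g : S.carrier → β}
    (hg : DependsOnPrefix N g) : (Set.range g).Finite := by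
  obtain ⟨ρ, hρ, -, hρx⟩ := exists_finite_agree S N
  refine (hρ.image g).subset ?_
  rintro _ ⟨x, rfl⟩
  exact ⟨ρ x, ⟨x, rfl⟩, hg _ _ (hρx x)⟩

theorem HasPath.congr {x x' y y' : S.carrier} {n : ℕ} {w : G} (h : HasPath N f x y n w)
    (hx : Agree N x x') (hy : Agree N y y') : HasPath N f x' y' n w := by
  obtain ⟨z, hzx, hzy, hz⟩ := h
  exact ⟨z, hzx.trans hx, hzy.trans hy, hz⟩

theorem DependsOnPrefix.continuous {β : Type*} [DiscreteTopology α] [TopologicalSpace β]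
    {g : S.carrier → β} (hg : DependsOnPrefix N g) : Continuous g := by
  refine IsLocallyConstant.continuous ((IsLocallyConstant.iff_exists_open g).2 fun x => ?_)
  exact ⟨_, isOpen_setOf_agree (N := N) x, fun _ _ => rfl, fun y hy => hg _ _ hy⟩

/-- Points whose cylinders are joined by paths of Birkhoff sum bounded below. -/
theorem IsTransitive.exists_hasPath_ge [Finite α] [DiscreteTopology α]
    (hT : IsTransitive (shiftMap S)) (N : ℕ) (f : S.carrier → ℝ) :
    ∃ C : ℝ, ∀ x y, ∃ n w, C ≤ w ∧ HasPath N f x y n w := by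
  obtain ⟨ρ, hρ, -, hρx⟩ := exists_finite_agree S N
  choose n w h using hT.exists_hasPath N f
  obtain ⟨C, hC⟩ := ((hρ.prod hρ).image fun p => w p.1 p.2).bddBelow
  refine ⟨C, fun x y => ⟨n (ρ x) (ρ y), w (ρ x) (ρ y), hC ?_, (h _ _).congr (hρx x) (hρx y)⟩⟩
  exact ⟨(ρ x, ρ y), ⟨⟨x, rfl⟩, y, rfl⟩, rfl⟩

end Paths

/-! ### Exact cancellation of drift -/

section Balance

variable {α : Type*} [TopologicalSpace α] [DiscreteTopology α] {S : Subshift α ℕ} {N : ℕ}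

theorem exists_nat_mul_eq_nat_mul {a b : ℚ} (ha : 0 ≤ a) (hb : 0 < b) :
    ∃ s t : ℕ, 0 < s ∧ s * a = t * b := by
  refine ⟨(a / b).den, (a / b).num.toNat, (a / b).pos, ?_⟩
  have h : ((a / b).num.toNat : ℚ) = (a / b).num := by
    exact_mod_cast Int.toNat_of_nonneg (Rat.num_nonneg.2 (div_nonneg ha hb.le))
  have h' := Rat.den_mul_eq_num (a / b)
  rw [h, ← h', mul_assoc, div_mul_cancel₀ _ hb.ne']

/-- Loops through two periodic orbits of opposite drift can be balanced exactly. -/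
theorem exists_isPeriodicPt_balanced (hS : HasMemory S N) (hT : IsTransitive (shiftMap S))
    {φ : S.carrier → ℚ} (hφ : DependsOnPrefix N φ) {ψ : S.carrier → ℝ} (hψ : DependsOnPrefix N ψ)
    {p q : S.carrier} {m n : ℕ} (hm : 0 < m) (hp : Function.IsPeriodicPt (shiftMap S) m p)
    (hq : Function.IsPeriodicPt (shiftMap S) n q)
    (hφp : 0 < birkhoffSum (shiftMap S) φ m p) (hφq : birkhoffSum (shiftMap S) φ n q < 0)
    (hpos : 0 < birkhoffSum (shiftMap S) ψ m p * (-(birkhoffSum (shiftMap S) φ n q : ℚ) : ℝ) +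
      birkhoffSum (shiftMap S) ψ n q * (birkhoffSum (shiftMap S) φ m p : ℚ)) :
    ∃ (z : S.carrier) (k : ℕ), 0 < k ∧ Function.IsPeriodicPt (shiftMap S) k z ∧
      birkhoffSum (shiftMap S) φ k z = 0 ∧ 0 < birkhoffSum (shiftMap S) ψ k z := by
  -- Pairing makes a single path carry both sums.
  let F : S.carrier → ℚ × ℝ := fun x => (φ x, ψ x)
  have hF : DependsOnPrefix N F := fun x y h => Prod.ext (hφ x y h) (hψ x y h)
  have hFsum : ∀ k z, birkhoffSum (shiftMap S) F k z =
      (birkhoffSum (shiftMap S) φ k z, birkhoffSum (shiftMap S) ψ k z) := fun k z => by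
    simp [birkhoffSum, F, Prod.ext_iff, Prod.fst_sum, Prod.snd_sum]
  have hP := hasPath_of_isPeriodicPt (N := N) (f := F) hp
  have hQ := hasPath_of_isPeriodicPt (N := N) (f := F) hq
  rw [hFsum] at hP hQ
  set X := birkhoffSum (shiftMap S) φ m p
  set X' := birkhoffSum (shiftMap S) φ n q
  set Y := birkhoffSum (shiftMap S) ψ m p
  set Y' := birkhoffSum (shiftMap S) ψ n q
  obtain ⟨i, u, hu⟩ := hT.exists_hasPath N F p q
  obtain ⟨j, v, hv⟩ := hT.exists_hasPath N F q p
  obtain ⟨a, b, ha, hab⟩ := exists_nat_mul_eq_nat_mul hφp.le (neg_pos.2 hφq)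
  -- The connecting detour has its own drift; repeated `c + 1` times, it is cancelled by copies of
  -- whichever orbit has the opposite sign.
  obtain ⟨c, a', b', hc⟩ : ∃ c a' b' : ℕ, (c + 1 : ℚ) * (u.1 + v.1) + a' * X + b' * X' = 0 := by
    rcases le_total 0 (u.1 + v.1) with h | h
    · obtain ⟨s, t, hs, hst⟩ := exists_nat_mul_eq_nat_mul h (neg_pos.2 hφq)
      refine ⟨s - 1, 0, t, ?_⟩
      rw [Nat.cast_sub hs]
      push_cast
      linarith
    · obtain ⟨s, t, hs, hst⟩ := exists_nat_mul_eq_nat_mul (neg_nonneg.2 h) hφp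
      refine ⟨s - 1, t, 0, ?_⟩
      rw [Nat.cast_sub hs]
      push_cast
      linarith
  have hη : 0 < a * Y + b * Y' := by
    have hX' : (0 : ℝ) < -(X' : ℝ) := by exact_mod_cast neg_pos.2 hφq
    have hab' : (a : ℝ) * X = b * -(X' : ℝ) := by exact_mod_cast hab
    have ha' : (0 : ℝ) < a := by exact_mod_cast ha
    refine pos_of_mul_pos_left (b := -(X' : ℝ)) ?_ hX'.le
    have : (a * Y + b * Y') * -(X' : ℝ) = a * (Y * (-(X' : ℝ)) + Y' * X) := by
      linear_combination (-Y') * hab'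
    rw [this]
    exact mul_pos ha' hpos
  -- Each block of `a` and `b` turns has zero drift and gains `a * Y + b * Y' > 0`; enough blocks
  -- outweigh the fixed cost of the detours.
  obtain ⟨k, hk⟩ := exists_nat_gt (-((c + 1) * (u.2 + v.2) + a' * Y + b' * Y') / (a * Y + b * Y'))
  rw [div_lt_iff₀ hη] at hk
  have hloop := (((hu.trans hS hF (hQ.nsmul hS hF ((k + 1) * b + b'))).trans hS hF hv).trans hS hF
    (hP.nsmul hS hF ((k + 1) * a + a'))).trans hS hF ((hu.trans hS hF hv).nsmul hS hF c)
  obtain ⟨z, hz, hzF⟩ := hloop.exists_isPeriodicPt hS hF (by positivity)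
  rw [hFsum, Prod.ext_iff] at hzF
  refine ⟨z, _, by positivity, hz, hzF.1.trans ?_, lt_of_lt_of_eq ?_ hzF.2.symm⟩
  · simp only [Prod.fst_add, Prod.smul_fst]
    simp only [nsmul_eq_mul]
    push_cast
    linear_combination hc + (k + 1 : ℚ) * hab
  · simp only [Prod.snd_add, Prod.smul_snd]
    simp only [nsmul_eq_mul]
    push_cast
    linarith

end Balance

/-! ### From periodic orbits to invariant measures -/

section Measure

theorem measurable_shiftMap {α : Type*} [TopologicalSpace α] [MeasurableSpace α]
    (S : Subshift α ℕ) : Measurable (shiftMap S) := by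
  refine Measurable.subtype_mk (measurable_pi_lambda _ fun i => ?_)
  exact (measurable_pi_apply (1 + i)).comp measurable_subtype_coe

variable {α : Type*} [Finite α] [TopologicalSpace α] [DiscreteTopology α]
  [MeasurableSpace α] [MeasurableSingletonClass α] {S : Subshift α ℕ} {N : ℕ}

theorem DependsOnPrefix.integrable {g : S.carrier → ℝ} (hg : DependsOnPrefix N g)
    (μ : Measure S.carrier) [IsFiniteMeasure μ] : Integrable g μ := by
  obtain ⟨C, hC⟩ := (hg.finite_range.image fun t => ‖t‖).bddAbove
  exact Integrable.of_bound hg.continuous.aestronglyMeasurable C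
    (Eventually.of_forall fun x => hC ⟨_, ⟨x, rfl⟩, rfl⟩)

theorem integral_birkhoffSum_of_mem_invariantMeasures {X : Type*} [MeasurableSpace X] {T : X → X}
    {μ : Measure X} (hμ : μ ∈ invariantMeasures T) {g : X → ℝ} (hg : Integrable g μ) (n : ℕ) :
    Integrable (birkhoffSum T g n) μ ∧ ∫ x, birkhoffSum T g n x ∂μ = n * ∫ x, g x ∂μ := by
  have hi : ∀ j, Integrable (fun x => g (T^[j] x)) μ := fun j =>
    (hμ.2.iterate j).integrable_comp_of_integrable hg
  have hc : ∀ j, ∫ x, g (T^[j] x) ∂μ = ∫ x, g x ∂μ := fun j => by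
    have h := hμ.2.iterate j
    conv_rhs => rw [← h.map_eq]
    exact (integral_map h.measurable.aemeasurable (by rw [h.map_eq]; exact hg.1)).symm
  refine ⟨integrable_finsetSum _ fun j _ => hi j, ?_⟩
  simp only [birkhoffSum]
  rw [integral_finsetSum _ fun j _ => hi j]
  simp [hc]

/-- If the Birkhoff sums over periodic orbits are nonpositive, so are the integrals with respect to
invariant measures: orbit segments close up at bounded cost. -/
theorem integral_nonpos_of_isPeriodicPt (hS : HasMemory S N) (hT : IsTransitive (shiftMap S))
    {ψ : S.carrier → ℝ} (hψ : DependsOnPrefix N ψ)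
    (h : ∀ (z : S.carrier) (k : ℕ), 0 < k → Function.IsPeriodicPt (shiftMap S) k z →
      birkhoffSum (shiftMap S) ψ k z ≤ 0)
    {μ : Measure S.carrier} (hμ : μ ∈ invariantMeasures (shiftMap S)) : ∫ x, ψ x ∂μ ≤ 0 := by
  have := hμ.1
  obtain ⟨C, hC⟩ := hT.exists_hasPath_ge N ψ
  have hbound : ∀ n : ℕ, 0 < n → ∀ x, birkhoffSum (shiftMap S) ψ n x ≤ -C := by
    intro n hn x
    obtain ⟨m, w, hw, hpath⟩ := hC ((shiftMap S)^[n] x) x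
    obtain ⟨z, hz, hzw⟩ := ((hasPath_iterate x n).trans hS hψ hpath).exists_isPeriodicPt hS hψ
      (by omega)
    have := h z _ (by omega) hz
    linarith
  by_contra! hpos
  obtain ⟨n, hn⟩ := exists_nat_gt (-C / ∫ x, ψ x ∂μ)
  rw [div_lt_iff₀ hpos] at hn
  obtain ⟨hi, he⟩ := integral_birkhoffSum_of_mem_invariantMeasures hμ (hψ.integrable μ) (n + 1)
  have := integral_mono hi (integrable_const (-C)) (hbound (n + 1) n.succ_pos)
  rw [he] at this
  simp at this
  linarith

theorem exists_isPeriodicPt_of_integral_pos (hS : HasMemory S N) (hT : IsTransitive (shiftMap S))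
    {φ : S.carrier → ℚ} (hφ : DependsOnPrefix N φ) {ψ : S.carrier → ℝ} (hψ : DependsOnPrefix N ψ)
    {μ ν ν' : Measure S.carrier} (hμ : μ ∈ invariantMeasures (shiftMap S))
    (hν : ν ∈ invariantMeasures (shiftMap S)) (hν' : ν' ∈ invariantMeasures (shiftMap S))
    (hμφ : ∫ x, (φ x : ℝ) ∂μ = 0) (hνφ : 0 < ∫ x, (φ x : ℝ) ∂ν)
    (hν'φ : ∫ x, (φ x : ℝ) ∂ν' < 0) (hμψ : 0 < ∫ x, ψ x ∂μ) :
    ∃ (z : S.carrier) (k : ℕ), 0 < k ∧ Function.IsPeriodicPt (shiftMap S) k z ∧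
      birkhoffSum (shiftMap S) φ k z = 0 ∧ 0 < birkhoffSum (shiftMap S) ψ k z := by
  have := hμ.1
  have hφ' : DependsOnPrefix N fun x => (φ x : ℝ) := fun x y h => congrArg _ (hφ x y h)
  have hcast : ∀ k z, birkhoffSum (shiftMap S) (fun x => (φ x : ℝ)) k z =
      (birkhoffSum (shiftMap S) φ k z : ℚ) := fun k z => by simp [birkhoffSum]
  by_contra! hcon
  let Per (σ : ℚ → Prop) : Set ℝ := {t | ∃ (z : S.carrier) (k : ℕ), 0 < k ∧
    Function.IsPeriodicPt (shiftMap S) k z ∧ σ (birkhoffSum (shiftMap S) φ k z) ∧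
      birkhoffSum (shiftMap S) ψ k z / (birkhoffSum (shiftMap S) φ k z : ℚ) = t}
  -- `a` acts as a Lagrange multiplier for the constraint. `ν` and `ν'` make the two sets of ratios
  -- nonempty; balancing orders them.
  obtain ⟨a, ha, ha'⟩ : (upperBounds (Per (0 < ·)) ∩ lowerBounds (Per (· < 0))).Nonempty := by
    refine exists_between_of_forall_le ?_ ?_ ?_
    · by_contra hempty
      refine hνφ.not_ge (integral_nonpos_of_isPeriodicPt hS hT hφ' (fun z k hk hz => ?_) hν)
      by_contra! hlt
      rw [hcast] at hlt
      exact hempty ⟨_, z, k, hk, hz, by exact_mod_cast hlt, rfl⟩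
    · by_contra hempty
      have : ∫ x, -(φ x : ℝ) ∂ν' ≤ 0 :=
        integral_nonpos_of_isPeriodicPt hS hT (N := N) (fun x y h => by rw [hφ x y h])
          (fun z k hk hz => by
            by_contra! hlt
            have hneg := birkhoffSum_neg (shiftMap S) (fun x => (φ x : ℝ)) k z
            rw [hcast] at hneg
            refine hempty ⟨_, z, k, hk, hz, ?_, rfl⟩
            have : 0 < -((birkhoffSum (shiftMap S) φ k z : ℚ) : ℝ) := hneg ▸ hlt
            exact_mod_cast neg_pos.1 this) hν'
      rw [integral_neg] at this
      linarith
    · rintro _ ⟨p, m, hm, hp, hpX, rfl⟩ _ ⟨q, n, hn, hq, hqX, rfl⟩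
      by_contra! hlt
      have hpX' : (0 : ℝ) < (birkhoffSum (shiftMap S) φ m p : ℚ) := by exact_mod_cast hpX
      have hqX' : ((birkhoffSum (shiftMap S) φ n q : ℚ) : ℝ) < 0 := by exact_mod_cast hqX
      obtain ⟨z, k, hk, hz, hz0, hzpos⟩ := exists_isPeriodicPt_balanced hS hT hφ hψ hm hp hq hpX hqX
        (by
          rw [lt_div_iff₀ hpX', div_mul_eq_mul_div, div_lt_iff_of_neg hqX'] at hlt
          linarith)
      exact (hcon z k hk hz hz0).not_gt hzpos
  have hle : ∫ x, (ψ x - a * φ x) ∂μ ≤ 0 := by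
    refine integral_nonpos_of_isPeriodicPt hS hT (N := N)
      (fun x y h => by rw [hφ x y h, hψ x y h]) (fun z k hk hz => ?_) hμ
    have hsum : birkhoffSum (shiftMap S) (fun x => ψ x - a * φ x) k z =
        birkhoffSum (shiftMap S) ψ k z - a * (birkhoffSum (shiftMap S) φ k z : ℚ) := by
      simp [birkhoffSum, Finset.mul_sum]
    rw [hsum, sub_nonpos]
    rcases lt_trichotomy (birkhoffSum (shiftMap S) φ k z) 0 with hlt | heq | hgt
    · exact (le_div_iff_of_neg (by exact_mod_cast hlt)).1 (ha' ⟨z, k, hk, hz, hlt, rfl⟩)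
    · simpa [heq] using hcon z k hk hz heq
    · exact (div_le_iff₀ (by exact_mod_cast hgt)).1 (ha ⟨z, k, hk, hz, hgt, rfl⟩)
  rw [integral_sub (hψ.integrable μ) ((hφ'.integrable μ).const_mul a), integral_const_mul, hμφ]
    at hle
  linarith

end Measure

/-! ### Measures on periodic orbits -/

section PeriodicMeasure

variable {X : Type*} [MeasurableSpace X] {T : X → X} {x : X} {M : ℕ}

/-- The measure equidistributed on the first `M` points of the orbit of `x`. -/
noncomputable def orbitMeasure (T : X → X) (M : ℕ) (x : X) : Measure X :=
  (M : ℝ≥0∞)⁻¹ • ∑ j ∈ Finset.range M, Measure.dirac (T^[j] x)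

theorem orbitMeasure_mem_invariantMeasures (hT : Measurable T) (hM : 0 < M)
    (hx : Function.IsPeriodicPt T M x) : orbitMeasure T M x ∈ invariantMeasures T := by
  refine ⟨⟨?_⟩, hT, ?_⟩
  · simp only [orbitMeasure, Measure.smul_apply, Measure.finsetSum_apply, measure_univ,
      Finset.sum_const, Finset.card_range, nsmul_eq_mul, mul_one, smul_eq_mul]
    exact ENNReal.inv_mul_cancel (by exact_mod_cast hM.ne') (ENNReal.natCast_ne_top M)
  · rw [orbitMeasure, Measure.map_smul, ← Measure.mapₗ_apply_of_measurable hT, map_sum]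
    congr 1
    simp only [Measure.mapₗ_apply_of_measurable hT, Measure.map_dirac' hT,
      ← Function.iterate_succ_apply' T]
    obtain ⟨k, rfl⟩ := Nat.exists_eq_succ_of_ne_zero hM.ne'
    rw [Finset.sum_range_succ, hx.eq, Finset.sum_range_succ' (fun j => Measure.dirac (T^[j] x))]
    rfl

theorem integral_orbitMeasure [MeasurableSingletonClass X] (g : X → ℝ) :
    ∫ y, g y ∂orbitMeasure T M x = (M : ℝ)⁻¹ * birkhoffSum T g M x := by
  rw [orbitMeasure, integral_smul_measure,
    integral_finsetSum_measure fun j _ => integrable_dirac (by simp)]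
  simp [integral_dirac, birkhoffSum]

end PeriodicMeasure

/-! ### Approximation by functions of finitely many coordinates -/

section Approximation

variable {α : Type*} [TopologicalSpace α] {S : Subshift α ℕ}

theorem shiftDist_le_pow {lam : ℝ≥0} (hlam : lam ≤ 1) {N : ℕ} {x y : S.carrier}
    (h : Agree N x y) : shiftDist S lam x y ≤ lam ^ N := by
  unfold shiftDist
  split_ifs with hxy
  · exact zero_le
  · refine pow_le_pow_of_le_one zero_le hlam ?_
    by_contra! hlt
    exact PiNat.apply_firstDiff_ne (E := fun _ => α) (fun h => hxy (Subtype.ext h)) (h _ hlt)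

theorem IsWalters.exists_dependsOnPrefix_near [Finite α] {lam : ℝ≥0} (hlam : lam < 1)
    {A : S.carrier → ℝ} (hA : IsWalters (shiftMap S) (shiftDist S lam) A) {δ : ℝ} (hδ : 0 < δ) :
    ∃ (N : ℕ) (g : S.carrier → ℝ), DependsOnPrefix N g ∧ ∀ x, |A x - g x| ≤ δ := by
  obtain ⟨-, H, -, H0, Hcont, hH⟩ := hA
  have hlim : Tendsto (fun N : ℕ => H (lam ^ N)) atTop (𝓝 0) :=
    H0 ▸ Hcont.tendsto.comp (NNReal.tendsto_pow_atTop_nhds_zero_of_lt_one hlam)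
  obtain ⟨N, hN⟩ := (hlim.eventually_lt_const (ENNReal.ofReal_pos.2 hδ)).exists
  obtain ⟨ρ, -, hρ, hρx⟩ := exists_finite_agree S N
  refine ⟨N, fun x => A (ρ x), fun x y h => congrArg A (hρ x y h), fun x => ?_⟩
  -- With `k = 1` the Walters condition is uniform continuity.
  have h := hH (lam ^ N) 1 one_pos x (ρ x)
    (by simpa [dynDist] using shiftDist_le_pow hlam.le (hρx x).symm)
  rw [birkhoffSum_one, birkhoffSum_one] at h
  exact (ENNReal.ofReal_le_ofReal_iff hδ.le).1 (h.trans hN.le)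

end Approximation

end ErgOpt

open ErgOpt

/-- The empty set has no least upper bound in `ℝ`, so `IsLUB` includes nonemptiness. -/
theorem proposition14 {α : Type*} [Finite α] [TopologicalSpace α] [DiscreteTopology α]
    [MeasurableSpace α] [MeasurableSingletonClass α]
    (S : SymbolicDynamics.FullShift.Subshift α ℕ)
    (hS : ErgOpt.IsFiniteType S)
    (hT : ErgOpt.IsTransitive (ErgOpt.shiftMap S))
    (lam : ℝ≥0) (hlam0 : 0 < lam) (hlam1 : lam < 1)
    (φ : S.carrier → ℚ) (hφ : ErgOpt.IsLocConst S φ)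
    (A : S.carrier → ℝ)
    (hA : ErgOpt.IsWalters (ErgOpt.shiftMap S) (ErgOpt.shiftDist S lam) A)
    (r : ℚ)
    (hr : (r : ℝ) ∈ interior (ErgOpt.rotationSet (ErgOpt.shiftMap S) (fun x => (φ x : ℝ)))) :
    IsLUB
      {a : ℝ | ∃ μ ∈ ErgOpt.rotationClass (ErgOpt.shiftMap S) (fun x => (φ x : ℝ)) (r : ℝ),
        ErgOpt.IsPeriodicMeasure (ErgOpt.shiftMap S) μ ∧ ∫ x, A x ∂μ = a}
      (ErgOpt.beta (ErgOpt.shiftMap S) A (fun x => (φ x : ℝ)) (r : ℝ)) := by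
  obtain ⟨N₀, hN₀⟩ := hS.exists_hasMemory
  obtain ⟨N₁, hN₁⟩ := hφ.exists_dependsOnPrefix
  have hφ' : DependsOnPrefix N₁ fun x => (φ x : ℝ) := fun x y h => congrArg _ (hN₁ x y h)
  have hAbound : ∃ C, ∀ x, ‖A x‖ ≤ C := by
    obtain ⟨N, g, hg, hgA⟩ := hA.exists_dependsOnPrefix_near hlam1 one_pos
    obtain ⟨C, hC⟩ := (hg.finite_range.image fun t => |t|).bddAbove
    refine ⟨1 + C, fun x => ?_⟩
    have h₁ : |g x| ≤ C := hC ⟨_, ⟨x, rfl⟩, rfl⟩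
    have h₂ := abs_add_le (A x - g x) (g x)
    rw [sub_add_cancel] at h₂
    rw [Real.norm_eq_abs]
    linarith [hgA x]
  obtain ⟨C, hC⟩ := hAbound
  have hAint : ∀ μ : Measure S.carrier, IsProbabilityMeasure μ → Integrable A μ := fun μ _ =>
    Integrable.of_bound hA.1.aestronglyMeasurable C (Eventually.of_forall hC)
  have hbdd : BddAbove ((fun μ : Measure S.carrier => ∫ x, A x ∂μ) ''
      rotationClass (shiftMap S) (fun x => (φ x : ℝ)) r) := by
    refine ⟨C, ?_⟩
    rintro _ ⟨μ, hμ, rfl⟩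
    have := hμ.1.1
    refine (le_abs_self _).trans ?_
    simpa using norm_integral_le_of_norm_le_const (μ := μ) (Eventually.of_forall hC)
  have hcenter : ∀ μ ∈ invariantMeasures (shiftMap S),
      ∫ x, ((φ x - r : ℚ) : ℝ) ∂μ = rotationNumber (fun x => (φ x : ℝ)) μ - r := by
    intro μ hμ
    have := hμ.1
    push_cast
    rw [integral_sub (hφ'.integrable μ) (integrable_const _)]
    simp [rotationNumber]
  obtain ⟨ε, hε, hball⟩ := Metric.mem_nhds_iff.1 (mem_interior_iff_mem_nhds.1 hr)
  obtain ⟨ν, hν, hνr⟩ := hball (show (r + ε / 2 : ℝ) ∈ Metric.ball (r : ℝ) ε by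
    rw [Metric.mem_ball, Real.dist_eq, add_sub_cancel_left, abs_of_pos (by linarith)]
    linarith)
  obtain ⟨ν', hν', hν'r⟩ := hball (show (r - ε / 2 : ℝ) ∈ Metric.ball (r : ℝ) ε by
    rw [Metric.mem_ball, Real.dist_eq, sub_sub_cancel_left, abs_neg, abs_of_pos (by linarith)]
    linarith)
  obtain ⟨μ₀, hμ₀, hμ₀r⟩ := interior_subset hr
  refine ⟨?_, fun b hb => csSup_le ⟨_, μ₀, ⟨hμ₀, hμ₀r⟩, rfl⟩ ?_⟩
  · rintro _ ⟨μ, hμ, -, rfl⟩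
    exact le_csSup hbdd ⟨μ, hμ, rfl⟩
  rintro _ ⟨μ, ⟨hμ, hμr⟩, rfl⟩
  have := hμ.1
  refine le_of_forall_pos_le_add fun δ hδ => ?_
  obtain ⟨N₂, g, hg, hgA⟩ := hA.exists_dependsOnPrefix_near hlam1 (δ := δ / 3) (by linarith)
  have hA_le : ∫ x, A x ∂μ ≤ ∫ x, g x ∂μ + δ / 3 := by
    have h := integral_mono (hAint μ hμ.1) ((hg.integrable μ).add (integrable_const (δ / 3)))
      (fun x => by
        have := (abs_le.1 (hgA x)).2
        simp only [Pi.add_apply]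
        linarith)
    simp only [Pi.add_apply] at h
    rw [integral_add (hg.integrable μ) (integrable_const _)] at h
    simpa using h
  -- The loss `δ` splits in three: `A` to `g` under `μ`, the margin making `∫ (g - c) dμ` positive,
  -- and `g` back to `A` on the periodic orbit.
  set c := ∫ x, g x ∂μ - δ / 3 with hc
  let N := max N₀ (max N₁ N₂)
  have hgc : ∫ x, (g x - c) ∂μ = δ / 3 := by
    rw [integral_sub (hg.integrable μ) (integrable_const _)]
    simp [hc]
  obtain ⟨z, k, hk, hz, hzφ, hzg⟩ := exists_isPeriodicPt_of_integral_pos (N := N)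
    (hN₀.mono (le_max_left _ _)) hT (φ := fun x => φ x - r) (ψ := fun x => g x - c)
    (fun x y h => congrArg (· - r) (hN₁.mono ((le_max_left _ _).trans (le_max_right _ _)) x y h))
    (fun x y h => congrArg (· - c) (hg.mono ((le_max_right _ _).trans (le_max_right _ _)) x y h))
    hμ hν hν' (by rw [hcenter μ hμ, hμr, sub_self]) (by rw [hcenter ν hν, hνr]; linarith)
    (by rw [hcenter ν' hν', hν'r]; linarith) (by rw [hgc]; linarith)
  have hk' : (0 : ℝ) < k := by exact_mod_cast hk
  have hinv := orbitMeasure_mem_invariantMeasures (measurable_shiftMap S) hk hz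
  have hrot : rotationNumber (fun x => (φ x : ℝ)) (orbitMeasure (shiftMap S) k z) = r := by
    have h := hcenter _ hinv
    rw [integral_orbitMeasure] at h
    have hcast : birkhoffSum (shiftMap S) (fun x => ((φ x - r : ℚ) : ℝ)) k z =
        (birkhoffSum (shiftMap S) (fun x => φ x - r) k z : ℚ) := by simp [birkhoffSum]
    rw [hcast, hzφ] at h
    simp at h
    linarith
  have hle := hb ⟨_, ⟨hinv, hrot⟩, ⟨z, k, hk, hz, rfl⟩, rfl⟩
  rw [integral_orbitMeasure] at hle
  have hsum : birkhoffSum (shiftMap S) (fun x => g x - c) k z ≤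
      birkhoffSum (shiftMap S) A k z - k * (c - δ / 3) := by
    have h : ∀ j ∈ Finset.range k, g ((shiftMap S)^[j] z) - c ≤
        A ((shiftMap S)^[j] z) - (c - δ / 3) := fun j _ => by
      have := (abs_le.1 (hgA ((shiftMap S)^[j] z))).1
      linarith
    simpa [birkhoffSum, Finset.sum_sub_distrib, mul_sub] using Finset.sum_le_sum h
  have hlow : c - δ / 3 ≤ (k : ℝ)⁻¹ * birkhoffSum (shiftMap S) A k z := by
    rw [le_inv_mul_iff₀ hk']
    linarith
  linarith
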